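/- Let $\mathcal H_A,\mathcal H_B$ be finite-dimensional complex Hilbert spaces, let $\rho_{AB}$ be a density matrix (positive semidefinite, unit trace) on $\mathcal H_A\otimes\mathcal H_B$, and let $\rho_A=\operatorname{Tr}_B\rho_{AB}$ and $\rho_B=\operatorname{Tr}_A\rho_{AB}$ be its reduced density matrices. For $0<\alpha<1$ define the Petz Rényi mutual information $$I_{\alpha,1}(A;B)=\frac{1}{\alpha-1}\log\operatorname{Tr}\!\left(\rho_{AB}^{\alpha}\,(\rho_A\otimes\rho_B)^{1-\alpha}\right),$$ where $\log$ is the natural logarithm, and for $\alpha=1$ let it be the limiting value $$I_{1,1}(A;B)=\operatorname{Tr}\!\left(\rho_{AB}\log\rho_{AB}-\rho_{AB}\log(\rho_A\otimes\rho_B)\right),$$ with the convention that logarithms are taken on the support. Let $\mathcal O_A\neq 0$ and $\mathcal O_B\neq 0$ be arbitrary linear operators on $\mathcal H_A$ and $\mathcal H_B$, with connected correlator $$\langle\mathcal O_A\mathcal O_B\rangle_c=\left|\operatorname{Tr}\!\left(\rho_{AB}(\mathcal O_A\otimes\mathcal O_B)\right)-\operatorname{Tr}\!\left(\rho_{AB}(\mathcal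 O_A\otimes 1)\right)\operatorname{Tr}\!\left(\rho_{AB}(1\otimes\mathcal O_B)\right)\right|,$$ and let $\|X\|_2=\left(\operatorname{Tr}\left(\sqrt{X^\dagger X}\right)^{2}\right)^{1/2}$ be the Schatten 2-norm (of $\mathcal O_A$ on $\mathcal H_A$ and of $\mathcal O_B$ on $\mathcal H_B$). Then for every $0<\alpha\le 1$, $$I_{\alpha,1}(A;B)\;\ge\;\frac{\alpha\,\langle\mathcal O_A\mathcal O_B\rangle_c^4}{2\,\|\mathcal O_A\|_2^4\,\|\mathcal O_B\|_2^4}.$$ -/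

import Mathlib

open scoped Matrix Kronecker ComplexOrder

noncomputable section

/-- A density matrix: a positive semidefinite Hermitian complex matrix of unit trace. -/
def IsDensityMatrix {n : Type*} [Fintype n] (ρ : Matrix n n ℂ) : Prop :=
  ρ.PosSemidef ∧ ρ.trace = 1

/-- The reduced matrix `ρ_A = Tr_B ρ_AB`. -/
def reducedA {a b : Type*} [Fintype b] (ρ : Matrix (a × b) (a × b) ℂ) : Matrix a a ℂ :=
  Matrix.of fun i j => ∑ k, ρ (i, k) (j, k)

/-- The reduced matrix `ρ_B = Tr_A ρ_AB`. -/
def reducedB {a b : Type*} [Fintype a] (ρ : Matrix (a × b) (a × b) ℂ) : Matrix b b ℂ :=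
  Matrix.of fun i j => ∑ k, ρ (k, i) (k, j)

/-- The real power `M ^ s` of a positive semidefinite matrix, by functional calculus
(the spectrum is finite, so every real function is continuous on it). -/
def psdPow {n : Type*} [Fintype n] [DecidableEq n] (M : Matrix n n ℂ) (s : ℝ) : Matrix n n ℂ :=
  cfc (fun x : ℝ => x ^ s) M

/-- The logarithm of a positive semidefinite matrix on its support, extended by zero to its
kernel. -/
def psdLog {n : Type*} [Fintype n] [DecidableEq n] (M : Matrix n n ℂ) : Matrix n n ℂ :=
  cfc Real.log M

/-- The Schatten norm `‖X‖_k = (Tr (√(X† X)) ^ k) ^ (1 / k)`. -/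
def schattenNorm {n : Type*} [Fintype n] [DecidableEq n] (k : ℝ) (X : Matrix n n ℂ) : ℝ :=
  (psdPow (cfc Real.sqrt (Xᴴ * X)) k).trace.re ^ (1 / k)

/-- The relative entropy `D(ρ‖σ) = Tr (ρ log ρ - ρ log σ)`, for density matrices such that the
support of `ρ` is contained in that of `σ`. -/
def relEntropy {n : Type*} [Fintype n] [DecidableEq n] (ρ σ : Matrix n n ℂ) : ℝ :=
  (ρ * psdLog ρ - ρ * psdLog σ).trace.re

/-- The Petz Rényi relative entropy `D_{α,1}(ρ‖σ) = (α - 1)⁻¹ log Tr (ρ ^ α σ ^ (1 - α))`, with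
its limiting value, the relative entropy, at `α = 1`; for density matrices such that the support
of `ρ` is contained in that of `σ` (then the trace is positive for `0 < α < 1`). -/
def petzRelEntropy {n : Type*} [Fintype n] [DecidableEq n] (α : ℝ) (ρ σ : Matrix n n ℂ) : ℝ :=
  if α = 1 then relEntropy ρ σ
  else 1 / (α - 1) * Real.log (psdPow ρ α * psdPow σ (1 - α)).trace.re

/-- The Petz Rényi mutual information `I_{α,1}(A;B) = D_{α,1}(ρ_AB ‖ ρ_A ⊗ ρ_B)` of a density
matrix `ρ = ρ_AB`. The support of `ρ_AB` is always contained in that of `ρ_A ⊗ ρ_B`, so the value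
is a genuine finite real number for `0 < α ≤ 1`. -/
def petzMutualInfo {a b : Type*} [Fintype a] [DecidableEq a] [Fintype b] [DecidableEq b]
    (α : ℝ) (ρ : Matrix (a × b) (a × b) ℂ) : ℝ :=
  petzRelEntropy α ρ (reducedA ρ ⊗ₖ reducedB ρ)

/-- The expectation value `⟨O⟩ = Tr (ρ O)`. -/
def expectation {n : Type*} [Fintype n] (ρ O : Matrix n n ℂ) : ℂ := (ρ * O).trace

/-- The connected correlator `⟨O_A O_B⟩_c = |⟨O_A O_B⟩ - ⟨O_A⟩⟨O_B⟩|`, where `O_A` acts as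
`O_A ⊗ 1` and `O_B` as `1 ⊗ O_B` on the joint system. -/
def connectedCorrelator {a b : Type*} [Fintype a] [DecidableEq a] [Fintype b] [DecidableEq b]
    (ρ : Matrix (a × b) (a × b) ℂ) (OA : Matrix a a ℂ) (OB : Matrix b b ℂ) : ℝ :=
  ‖expectation ρ ((OA ⊗ₖ (1 : Matrix b b ℂ)) * ((1 : Matrix a a ℂ) ⊗ₖ OB))
    - expectation ρ (OA ⊗ₖ (1 : Matrix b b ℂ)) * expectation ρ ((1 : Matrix a a ℂ) ⊗ₖ OB)‖

end

/-! Write `σ = ρ_A ⊗ ρ_B`, `r = √ρ`, `s = √σ`, `c` for the connected correlator and `N = ‖O_A‖₂²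
‖O_B‖₂²`. Two estimates of `c` are combined.

The first compares states. In eigenbases of `ρ` and `σ` the Petz divergence becomes a classical
expression weighted by the squared overlaps `|⟨u_i, v_j⟩|²`. Scalar inequalities then give `I ≥ α (2
- 2 Tr (r s)) = α ‖r - s‖₂²` (`mul_le_petzRelEntropy`). Since `ρ - σ = (r - s) r + s (r - s)` with
`‖r‖₂ = ‖s‖₂ = 1`, Cauchy-Schwarz gives `c² ≤ 4 ‖r - s‖₂² N`. Hence `α c² ≤ 4 I N`
(`mul_norm_trace_sub_sq_le_petzMutualInfo`).

The second does not involve `I`: `2 c² ≤ N` (`two_mul_connectedCorrelator_sq_le`), from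
Cauchy-Schwarz on the centred operators and a bound on the symmetrized variance. Together, `2 α c⁴ ≤
α c² N ≤ 4 I N²`. -/

/-- The squared Frobenius norm of a complex matrix. -/
noncomputable def frobSq {m n : Type*} [Fintype m] [Fintype n] (X : Matrix m n ℂ) : ℝ :=
  ∑ i, ∑ j, ‖X i j‖ ^ 2

/-- The matrix `U diag(d) U†`. -/
noncomputable def conjDiag {n : Type*} [Fintype n] [DecidableEq n] (U : Matrix n n ℂ) (d : n → ℝ) :
    Matrix n n ℂ :=
  U * Matrix.diagonal (fun i => (d i : ℂ)) * Uᴴ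

/-! ### Frobenius norm: trace formulas, Cauchy-Schwarz, submultiplicativity. -/

section Frobenius

variable {l m n : Type*} [Fintype l] [Fintype m] [Fintype n]

lemma frobSq_nonneg (X : Matrix m n ℂ) : 0 ≤ frobSq X := by unfold frobSq; positivity

lemma frobSq_pos {X : Matrix m n ℂ} (hX : X ≠ 0) : 0 < frobSq X := by
  refine (frobSq_nonneg X).lt_of_ne fun h => hX ?_
  ext i j
  have h1 := (Finset.sum_eq_zero_iff_of_nonneg fun i _ => by positivity).1 h.symm i
    (Finset.mem_univ i)
  have h2 := (Finset.sum_eq_zero_iff_of_nonneg fun i _ => by positivity).1 h1 j (Finset.mem_univ j)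
  simpa using h2

lemma frobSq_conjTranspose (X : Matrix m n ℂ) : frobSq Xᴴ = frobSq X := by
  unfold frobSq
  rw [Finset.sum_comm]
  simp [Matrix.conjTranspose_apply]

lemma trace_conjTranspose_mul_self (X : Matrix m n ℂ) : (Xᴴ * X).trace = (frobSq X : ℂ) := by
  unfold frobSq
  rw [Finset.sum_comm]
  simp only [Matrix.trace, Matrix.diag, Matrix.mul_apply, Matrix.conjTranspose_apply]
  push_cast
  refine Finset.sum_congr rfl fun i _ => Finset.sum_congr rfl fun j _ => ?_
  rw [RCLike.star_def, Complex.conj_mul']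

lemma trace_mul_conjTranspose_self (X : Matrix m n ℂ) : (X * Xᴴ).trace = (frobSq X : ℂ) := by
  rw [Matrix.trace_mul_comm, trace_conjTranspose_mul_self]

lemma norm_sum_mul_sq_le {ι : Type*} (s : Finset ι) (x y : ι → ℂ) :
    ‖∑ i ∈ s, x i * y i‖ ^ 2 ≤ (∑ i ∈ s, ‖x i‖ ^ 2) * ∑ i ∈ s, ‖y i‖ ^ 2 := by
  refine le_trans ?_ (Finset.sum_mul_sq_le_sq_mul_sq s _ _)
  gcongr
  exact (norm_sum_le _ _).trans_eq (Finset.sum_congr rfl fun i _ => norm_mul _ _)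

lemma norm_trace_mul_sq_le (X : Matrix m n ℂ) (Y : Matrix n m ℂ) :
    ‖(X * Y).trace‖ ^ 2 ≤ frobSq X * frobSq Y := by
  have h := norm_sum_mul_sq_le Finset.univ (fun q : m × n => X q.1 q.2) (fun q => Y q.2 q.1)
  simp only [Fintype.sum_prod_type] at h
  rw [Finset.sum_comm (f := fun i j => ‖Y j i‖ ^ 2)] at h
  exact h

lemma frobSq_mul_le (X : Matrix l m ℂ) (Y : Matrix m n ℂ) :
    frobSq (X * Y) ≤ frobSq X * frobSq Y := by
  unfold frobSq
  rw [Finset.sum_comm (f := fun i j => ‖Y i j‖ ^ 2), Finset.sum_mul]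
  refine Finset.sum_le_sum fun i _ => ?_
  rw [Finset.mul_sum]
  exact Finset.sum_le_sum fun j _ => norm_sum_mul_sq_le _ _ _

end Frobenius

/-! ### Explicit diagonalizations and functional calculus. -/

section Spectral

variable {n : Type*} [Fintype n] [DecidableEq n]

lemma Matrix.PosSemidef.exists_eq_conjDiag {M : Matrix n n ℂ} (hM : M.PosSemidef) :
    ∃ (U : Matrix n n ℂ) (d : n → ℝ), Uᴴ * U = 1 ∧ U * Uᴴ = 1 ∧ (∀ i, 0 ≤ d i) ∧
      M = conjDiag U d := by
  refine ⟨hM.1.eigenvectorUnitary, hM.1.eigenvalues, ?_, ?_, hM.eigenvalues_nonneg, ?_⟩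
  · exact Unitary.coe_star_mul_self hM.1.eigenvectorUnitary
  · exact Unitary.coe_mul_star_self hM.1.eigenvectorUnitary
  · conv_lhs => rw [hM.1.spectral_theorem, Unitary.conjStarAlgAut_apply]
    rfl

lemma conjDiag_isHermitian (U : Matrix n n ℂ) (d : n → ℝ) : (conjDiag U d)ᴴ = conjDiag U d := by
  simp only [conjDiag, Matrix.conjTranspose_mul, Matrix.conjTranspose_conjTranspose,
    Matrix.diagonal_conjTranspose, mul_assoc]
  congr 3
  ext i
  simp

lemma conjDiag_mul_conjDiag {U : Matrix n n ℂ} (hU : Uᴴ * U = 1) (d e : n → ℝ) :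
    conjDiag U d * conjDiag U e = conjDiag U (fun i => d i * e i) := by
  have : conjDiag U d * conjDiag U e = U * Matrix.diagonal (fun i => (d i : ℂ)) * (Uᴴ * U) *
      Matrix.diagonal (fun i => (e i : ℂ)) * Uᴴ := by simp only [conjDiag, mul_assoc]
  rw [this, hU, mul_one, mul_assoc U, Matrix.diagonal_mul_diagonal]
  simp [conjDiag]

/-- Entrywise the hypothesis is `d i * W i j = W i j * e j`, so `d i = e j` wherever `W i j ≠ 0`. -/
lemma diagonal_comp_mul_eq {d e : n → ℝ} {W : Matrix n n ℂ} (f : ℝ → ℝ)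
    (h : Matrix.diagonal (fun i => (d i : ℂ)) * W = W * Matrix.diagonal (fun i => (e i : ℂ))) :
    Matrix.diagonal (fun i => (f (d i) : ℂ)) * W =
      W * Matrix.diagonal (fun i => (f (e i) : ℂ)) := by
  ext i j
  have h1 := congrFun (congrFun h i) j
  rw [Matrix.diagonal_mul, Matrix.mul_diagonal] at h1 ⊢
  by_cases hW : W i j = 0
  · simp [hW]
  · have : d i = e j := by
      rw [mul_comm] at h1
      exact_mod_cast mul_left_cancel₀ hW h1
    rw [this, mul_comm]

/-- `cfc` is defined through one chosen eigenbasis `V`. The matrix `Vᴴ * U` intertwines the two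
diagonal forms, hence also their images under `f`, so any diagonalization may be used. -/
lemma cfc_conjDiag {U : Matrix n n ℂ} (hU : Uᴴ * U = 1) (hU' : U * Uᴴ = 1) (d : n → ℝ)
    (f : ℝ → ℝ) : cfc f (conjDiag U d) = conjDiag U (fun i => f (d i)) := by
  have hM : (conjDiag U d).IsHermitian := conjDiag_isHermitian U d
  rw [hM.cfc_eq, Matrix.IsHermitian.cfc, Unitary.conjStarAlgAut_apply]
  set V := (hM.eigenvectorUnitary : Matrix n n ℂ)
  have hV : Vᴴ * V = 1 := Unitary.coe_star_mul_self hM.eigenvectorUnitary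
  have hV' : V * Vᴴ = 1 := Unitary.coe_mul_star_self hM.eigenvectorUnitary
  have hspec : conjDiag U d = conjDiag V hM.eigenvalues := by
    conv_lhs => rw [hM.spectral_theorem, Unitary.conjStarAlgAut_apply]
    rfl
  have key : Matrix.diagonal (fun i => (hM.eigenvalues i : ℂ)) * (Vᴴ * U) =
      (Vᴴ * U) * Matrix.diagonal (fun i => (d i : ℂ)) := by
    have h1 : Vᴴ * conjDiag V hM.eigenvalues * U =
        (Vᴴ * V) * Matrix.diagonal (fun i => (hM.eigenvalues i : ℂ)) * (Vᴴ * U) := by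
      simp only [conjDiag, mul_assoc]
    have h2 : Vᴴ * conjDiag U d * U =
        (Vᴴ * U) * Matrix.diagonal (fun i => (d i : ℂ)) * (Uᴴ * U) := by
      simp only [conjDiag, mul_assoc]
    rw [hV, one_mul] at h1
    rw [hU, mul_one] at h2
    rw [← h1, ← h2, ← hspec]
  have key2 := diagonal_comp_mul_eq f key
  calc V * Matrix.diagonal (fun i => (f (hM.eigenvalues i) : ℂ)) * Vᴴ
      = V * (Matrix.diagonal (fun i => (f (hM.eigenvalues i) : ℂ)) * (Vᴴ * U)) * Uᴴ := by
        simp only [mul_assoc, hU', mul_one]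
    _ = (V * Vᴴ) * U * Matrix.diagonal (fun i => (f (d i) : ℂ)) * Uᴴ := by
        rw [key2]; simp only [mul_assoc]
    _ = conjDiag U (fun i => f (d i)) := by rw [hV', one_mul]; rfl

lemma trace_conjDiag {U : Matrix n n ℂ} (hU : Uᴴ * U = 1) (d : n → ℝ) :
    (conjDiag U d).trace = ((∑ i, d i : ℝ) : ℂ) := by
  rw [conjDiag, Matrix.trace_mul_comm, ← mul_assoc, hU, one_mul, Matrix.trace_diagonal]
  simp

lemma trace_conjDiag_mul (U X : Matrix n n ℂ) (d : n → ℝ) :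
    (conjDiag U d * X).trace = ∑ i, (d i : ℂ) * (Uᴴ * X * U) i i := by
  have : (conjDiag U d * X).trace =
      (Matrix.diagonal (fun i => (d i : ℂ)) * (Uᴴ * X * U)).trace := by
    rw [conjDiag, mul_assoc, mul_assoc, Matrix.trace_mul_comm]
    simp only [mul_assoc]
  rw [this]
  simp [Matrix.trace, Matrix.diagonal_mul]

/-- The passage from matrices to classical sums: the squared overlaps form a doubly stochastic
array. -/
lemma trace_conjDiag_mul_conjDiag (U V : Matrix n n ℂ) (d e : n → ℝ) :
    (conjDiag U d * conjDiag V e).trace.re =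
      ∑ i, ∑ j, ‖(Uᴴ * V) i j‖ ^ 2 * (d i * e j) := by
  rw [trace_conjDiag_mul]
  have h : Uᴴ * conjDiag V e * U =
      (Uᴴ * V) * Matrix.diagonal (fun i => (e i : ℂ)) * (Uᴴ * V)ᴴ := by
    simp only [conjDiag, Matrix.conjTranspose_mul, Matrix.conjTranspose_conjTranspose, mul_assoc]
  rw [h]
  have : ∀ i, (d i : ℂ) * ((Uᴴ * V) * Matrix.diagonal (fun i => (e i : ℂ)) * (Uᴴ * V)ᴴ) i i
      = ((∑ j, ‖(Uᴴ * V) i j‖ ^ 2 * (d i * e j) : ℝ) : ℂ) := by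
    intro i
    rw [Matrix.mul_apply, Finset.mul_sum]
    push_cast
    refine Finset.sum_congr rfl fun j _ => ?_
    rw [Matrix.mul_diagonal, Matrix.conjTranspose_apply, RCLike.star_def, ← Complex.mul_conj']
    ring
  simp only [this]
  rw [← Complex.ofReal_sum, Complex.ofReal_re]

lemma sum_norm_sq_row {W : Matrix n n ℂ} (hW : W * Wᴴ = 1) (i : n) : ∑ j, ‖W i j‖ ^ 2 = 1 := by
  have h := congrFun (congrFun hW i) i
  rw [Matrix.mul_apply, Matrix.one_apply_eq] at h
  have : ((∑ j, ‖W i j‖ ^ 2 : ℝ) : ℂ) = 1 := by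
    rw [← h]
    push_cast
    refine Finset.sum_congr rfl fun j _ => ?_
    rw [Matrix.conjTranspose_apply, RCLike.star_def, Complex.mul_conj']
  exact_mod_cast this

lemma sum_norm_sq_col {W : Matrix n n ℂ} (hW : Wᴴ * W = 1) (j : n) : ∑ i, ‖W i j‖ ^ 2 = 1 := by
  have := sum_norm_sq_row (W := Wᴴ) (by simpa using hW) j
  simpa [Matrix.conjTranspose_apply] using this

lemma schattenNorm_two_sq (X : Matrix n n ℂ) : schattenNorm 2 X ^ 2 = frobSq X := by
  obtain ⟨U, d, hU, hU', hd, hX⟩ :=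
    (Matrix.posSemidef_conjTranspose_mul_self X).exists_eq_conjDiag
  have h : psdPow (cfc Real.sqrt (Xᴴ * X)) 2 = Xᴴ * X := by
    rw [psdPow, hX, cfc_conjDiag hU hU', cfc_conjDiag hU hU']
    congr 1
    ext i
    norm_cast
    exact Real.sq_sqrt (hd i)
  rw [schattenNorm, h, trace_conjTranspose_mul_self, Complex.ofReal_re, ← Real.sqrt_eq_rpow,
    Real.sq_sqrt (frobSq_nonneg X)]

end Spectral

/-! ### Scalar and overlap-weighted inequalities for the divergences. -/

section Overlap

/-- Weighted AM-GM for `p ^ α * q ^ (1 - α) = (√p * √q) ^ (2 * (1 - α)) * p ^ (2 * α - 1)`. -/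
lemma rpow_mul_rpow_le_of_half_le {α p q : ℝ} (hα : 1 / 2 ≤ α) (hα₁ : α < 1) (hp : 0 ≤ p)
    (hq : 0 ≤ q) :
    p ^ α * q ^ (1 - α) ≤ 2 * (1 - α) * (√p * √q) + (2 * α - 1) * p := by
  have h := Real.geom_mean_le_arith_mean2_weighted (w₁ := 2 * (1 - α)) (w₂ := 2 * α - 1)
    (p₁ := √p * √q) (p₂ := p) (by linarith) (by linarith) (by positivity) hp (by ring)
  refine le_trans (le_of_eq ?_) h
  rw [Real.mul_rpow (by positivity) (by positivity), Real.sqrt_eq_rpow, Real.sqrt_eq_rpow,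
    ← Real.rpow_mul hp, ← Real.rpow_mul hq, mul_right_comm,
    ← Real.rpow_add_of_nonneg hp (by linarith) (by linarith)]
  congr 2 <;> ring

lemma rpow_mul_rpow_le_of_le_half {α p q : ℝ} (hα₀ : 0 < α) (hα : α ≤ 1 / 2) (hp : 0 ≤ p)
    (hq : 0 ≤ q) :
    p ^ α * q ^ (1 - α) ≤ 2 * α * (√p * √q) + (1 - 2 * α) * q := by
  have h := rpow_mul_rpow_le_of_half_le (α := 1 - α) (by linarith) (by linarith) hq hp
  rw [sub_sub_cancel] at h
  linarith

/-- This is `log x ≤ x - 1` at `x = √q / √p`, multiplied by `2 * p`. -/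
lemma two_mul_sub_sqrt_le_mul_log {p q : ℝ} (hp : 0 ≤ p) (hq : 0 < q) :
    2 * p - 2 * (√p * √q) ≤ p * Real.log p - p * Real.log q := by
  rcases hp.eq_or_lt with rfl | hp
  · simp
  have hlog := Real.log_le_sub_one_of_pos (x := √q / √p) (by positivity)
  rw [Real.log_div (by positivity) (by positivity), Real.log_sqrt hq.le, Real.log_sqrt hp.le] at hlog
  have h2 : p * (√q / √p) = √p * √q := by
    have := Real.sqrt_pos.2 hp
    field_simp
    rw [Real.sq_sqrt hp.le]
  have := mul_le_mul_of_nonneg_left hlog hp.le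
  rw [mul_sub, mul_sub p _ 1, h2] at this
  linarith

variable {m n : Type*} [Fintype m] [Fintype n] {w : m → n → ℝ} {p : m → ℝ} {q : n → ℝ}

lemma sum_overlap_mul_left (hrow : ∀ i, ∑ j, w i j = 1) (p : m → ℝ) :
    ∑ i, ∑ j, w i j * p i = ∑ i, p i := by
  simp_rw [← Finset.sum_mul, hrow, one_mul]

lemma sum_overlap_mul_right (hcol : ∀ j, ∑ i, w i j = 1) (q : n → ℝ) :
    ∑ i, ∑ j, w i j * q j = ∑ j, q j := by
  rw [Finset.sum_comm]
  simp_rw [← Finset.sum_mul, hcol, one_mul]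

/-- If the sum vanished, every `w i j * p i` would be zero, with `hsupp` covering `q j = 0`; but
these products add up to `1`. Positivity is what allows `log Q ≤ Q - 1` later. -/
lemma sum_overlap_rpow_pos (hw : ∀ i j, 0 ≤ w i j) (hrow : ∀ i, ∑ j, w i j = 1)
    (hp : ∀ i, 0 ≤ p i) (hq : ∀ j, 0 ≤ q j) (hp1 : ∑ i, p i = 1)
    (hsupp : ∀ i j, q j = 0 → w i j * p i = 0) (s t : ℝ) :
    0 < ∑ i, ∑ j, w i j * (p i ^ s * q j ^ t) := by
  have hnn : ∀ i j, 0 ≤ w i j * (p i ^ s * q j ^ t) := fun i j =>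
    mul_nonneg (hw i j) (mul_nonneg (Real.rpow_nonneg (hp i) _) (Real.rpow_nonneg (hq j) _))
  refine (Finset.sum_nonneg fun i _ => Finset.sum_nonneg fun j _ => hnn i j).lt_of_ne fun h => ?_
  have hz : ∀ i j, w i j * p i = 0 := by
    intro i j
    by_cases hqj : q j = 0
    · exact hsupp i j hqj
    by_cases hpi : p i = 0
    · simp [hpi]
    have h1 := (Finset.sum_eq_zero_iff_of_nonneg fun i _ =>
      Finset.sum_nonneg fun j _ => hnn i j).1 h.symm i (Finset.mem_univ i)
    have h2 := (Finset.sum_eq_zero_iff_of_nonneg fun j _ => hnn i j).1 h1 j (Finset.mem_univ j)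
    have hpos : 0 < p i ^ s * q j ^ t :=
      mul_pos (Real.rpow_pos_of_pos ((hp i).lt_of_ne' hpi) _)
        (Real.rpow_pos_of_pos ((hq j).lt_of_ne' hqj) _)
    rcases mul_eq_zero.1 h2 with h3 | h3
    · simp [h3]
    · exact absurd h3 hpos.ne'
  have := sum_overlap_mul_left hrow p
  simp [hz, hp1] at this

lemma mul_le_renyi_overlap (hw : ∀ i j, 0 ≤ w i j) (hrow : ∀ i, ∑ j, w i j = 1)
    (hcol : ∀ j, ∑ i, w i j = 1)
    (hp : ∀ i, 0 ≤ p i) (hq : ∀ j, 0 ≤ q j) (hp1 : ∑ i, p i = 1) (hq1 : ∑ j, q j = 1)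
    (hsupp : ∀ i j, q j = 0 → w i j * p i = 0) {α : ℝ} (hα₀ : 0 < α) (hα₁ : α < 1) :
    α * (2 - 2 * ∑ i, ∑ j, w i j * (√(p i) * √(q j))) ≤
      1 / (α - 1) * Real.log (∑ i, ∑ j, w i j * (p i ^ α * q j ^ (1 - α))) := by
  have hQ := sum_overlap_rpow_pos hw hrow hp hq hp1 hsupp α (1 - α)
  have hlog := Real.log_le_sub_one_of_pos hQ
  set Q := ∑ i, ∑ j, w i j * (p i ^ α * q j ^ (1 - α))
  set S := ∑ i, ∑ j, w i j * (√(p i) * √(q j))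
  have hS : S ≤ 1 := by
    have : 2 * S ≤ ∑ i, ∑ j, w i j * p i + ∑ i, ∑ j, w i j * q j := by
      simp only [S, Finset.mul_sum, ← Finset.sum_add_distrib]
      refine Finset.sum_le_sum fun i _ => Finset.sum_le_sum fun j _ => ?_
      have h1 := Real.sq_sqrt (hp i)
      have h2 := Real.sq_sqrt (hq j)
      have h3 := mul_le_mul_of_nonneg_left (two_mul_le_add_sq (√(p i)) (√(q j))) (hw i j)
      rw [h1, h2] at h3
      linarith
    rw [sum_overlap_mul_left hrow, sum_overlap_mul_right hcol, hp1, hq1] at this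
    linarith
  -- The two ranges of `α` give `1 - Q ≥ 2 (1 - α) (1 - S)` and `1 - Q ≥ 2 α (1 - S)` respectively.
  -- Each dominates `2 α (1 - α) (1 - S)` because `S ≤ 1`.
  have key : α * (2 - 2 * S) * (1 - α) ≤ 1 - Q := by
    rcases le_total (1 / 2) α with h | h
    · have hb : Q ≤ 2 * (1 - α) * S + (2 * α - 1) * ∑ i, ∑ j, w i j * p i := by
        simp only [Q, S, Finset.mul_sum, ← Finset.sum_add_distrib]
        refine Finset.sum_le_sum fun i _ => Finset.sum_le_sum fun j _ => ?_
        have := mul_le_mul_of_nonneg_left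
          (rpow_mul_rpow_le_of_half_le h hα₁ (hp i) (hq j)) (hw i j)
        linarith
      rw [sum_overlap_mul_left hrow, hp1] at hb
      nlinarith [mul_nonneg (mul_nonneg (sub_nonneg.2 hα₁.le) (sub_nonneg.2 hα₁.le))
        (sub_nonneg.2 hS)]
    · have hb : Q ≤ 2 * α * S + (1 - 2 * α) * ∑ i, ∑ j, w i j * q j := by
        simp only [Q, S, Finset.mul_sum, ← Finset.sum_add_distrib]
        refine Finset.sum_le_sum fun i _ => Finset.sum_le_sum fun j _ => ?_
        have := mul_le_mul_of_nonneg_left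
          (rpow_mul_rpow_le_of_le_half hα₀ h (hp i) (hq j)) (hw i j)
        linarith
      rw [sum_overlap_mul_right hcol, hq1] at hb
      nlinarith [mul_nonneg (mul_nonneg hα₀.le hα₀.le) (sub_nonneg.2 hS)]
  have hα : 0 < 1 - α := by linarith
  have : 1 / (α - 1) * Real.log Q = -Real.log Q / (1 - α) := by
    have : α - 1 ≠ 0 := by linarith
    field_simp
    ring
  rw [this, le_div_iff₀ hα]
  linarith

lemma le_relEntropy_overlap (hw : ∀ i j, 0 ≤ w i j) (hrow : ∀ i, ∑ j, w i j = 1)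
    (hp : ∀ i, 0 ≤ p i) (hq : ∀ j, 0 ≤ q j) (hp1 : ∑ i, p i = 1)
    (hsupp : ∀ i j, q j = 0 → w i j * p i = 0) :
    2 - 2 * ∑ i, ∑ j, w i j * (√(p i) * √(q j)) ≤
      ∑ i, p i * Real.log (p i) - ∑ i, ∑ j, w i j * (p i * Real.log (q j)) := by
  have h2 : (2 : ℝ) = 2 * ∑ i, ∑ j, w i j * p i := by
    rw [sum_overlap_mul_left hrow, hp1, mul_one]
  rw [← sum_overlap_mul_left hrow (fun i => p i * Real.log (p i))]
  nth_rw 1 [h2]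
  simp only [Finset.mul_sum, ← Finset.sum_sub_distrib]
  refine Finset.sum_le_sum fun i _ => Finset.sum_le_sum fun j _ => ?_
  rcases (hq j).eq_or_lt with h | h
  -- Here `Real.log 0 = 0` is harmless: the support condition annihilates the whole term.
  · have h0 := hsupp i j h.symm
    rw [← h]
    simp only [Real.sqrt_zero, Real.log_zero, mul_zero, sub_zero, ← mul_assoc, h0, zero_mul]
    simp
  · have := mul_le_mul_of_nonneg_left (two_mul_sub_sqrt_le_mul_log (hp i) h) (hw i j)
    linarith

end Overlap

/-! ### From the Petz divergence to the distance of square roots and to expectation values. -/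

section Petz

variable {n : Type*} [Fintype n] [DecidableEq n]

lemma mul_le_petzRelEntropy {U V : Matrix n n ℂ} (hU : Uᴴ * U = 1) (hU' : U * Uᴴ = 1)
    (hV : Vᴴ * V = 1) (hV' : V * Vᴴ = 1) {p q : n → ℝ} (hp : ∀ i, 0 ≤ p i) (hq : ∀ j, 0 ≤ q j)
    (hp1 : ∑ i, p i = 1) (hq1 : ∑ j, q j = 1)
    (hsupp : ∀ j, q j = 0 → (Vᴴ * conjDiag U p * V) j j = 0)
    {α : ℝ} (hα₀ : 0 < α) (hα₁ : α ≤ 1) :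
    α * (2 - 2 * (conjDiag U (fun i => √(p i)) * conjDiag V (fun j => √(q j))).trace.re) ≤
      petzRelEntropy α (conjDiag U p) (conjDiag V q) := by
  have hW : (Uᴴ * V)ᴴ * (Uᴴ * V) = 1 := by
    rw [Matrix.conjTranspose_mul, Matrix.conjTranspose_conjTranspose, mul_assoc, ← mul_assoc U,
      hU', one_mul, hV]
  have hW' : (Uᴴ * V) * (Uᴴ * V)ᴴ = 1 := mul_eq_one_comm.1 hW
  have hw : ∀ i j, 0 ≤ ‖(Uᴴ * V) i j‖ ^ 2 := fun i j => by positivity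
  have hs : ∀ i j, q j = 0 → ‖(Uᴴ * V) i j‖ ^ 2 * p i = 0 := by
    intro i j hj
    have h := hsupp j hj
    have h1 : Vᴴ * conjDiag U p * V =
        (Uᴴ * V)ᴴ * (Matrix.diagonal (fun i => (p i : ℂ)) * (Uᴴ * V)) := by
      simp only [conjDiag, Matrix.conjTranspose_mul, Matrix.conjTranspose_conjTranspose, mul_assoc]
    -- The diagonal entry in `hsupp` is a sum of nonnegative terms, so its vanishing kills each of
    -- them.
    have h2 : ((∑ i, ‖(Uᴴ * V) i j‖ ^ 2 * p i : ℝ) : ℂ) = 0 := by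
      rw [← h, h1, Matrix.mul_apply]
      push_cast
      refine Finset.sum_congr rfl fun i _ => ?_
      rw [Matrix.diagonal_mul, Matrix.conjTranspose_apply, RCLike.star_def, ← Complex.conj_mul']
      ring
    exact (Finset.sum_eq_zero_iff_of_nonneg fun i _ => mul_nonneg (hw i j) (hp i)).1
      (by exact_mod_cast h2) i (Finset.mem_univ i)
  rw [trace_conjDiag_mul_conjDiag]
  unfold petzRelEntropy
  split_ifs with h1
  · rw [h1, one_mul, relEntropy, psdLog, psdLog, cfc_conjDiag hU hU', cfc_conjDiag hV hV',
      Matrix.trace_sub, Complex.sub_re, trace_conjDiag_mul_conjDiag U V,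
      conjDiag_mul_conjDiag hU, trace_conjDiag hU, Complex.ofReal_re]
    exact le_relEntropy_overlap hw (sum_norm_sq_row hW') hp hq hp1 hs
  · rw [psdPow, psdPow, cfc_conjDiag hU hU', cfc_conjDiag hV hV', trace_conjDiag_mul_conjDiag]
    exact mul_le_renyi_overlap hw (sum_norm_sq_row hW') (sum_norm_sq_col hW) hp hq hp1 hq1 hs hα₀
      (lt_of_le_of_ne hα₁ h1)

/-- The expectation values of two positive matrices of unit trace differ by at most a multiple of
the Hilbert-Schmidt distance of their square roots. -/
lemma norm_trace_sub_mul_sq_le {r s : Matrix n n ℂ} (hr : rᴴ = r) (hs : sᴴ = s)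
    (hr1 : (r * r).trace = 1) (hs1 : (s * s).trace = 1) (O : Matrix n n ℂ) :
    ‖((r * r - s * s) * O).trace‖ ^ 2 ≤ 4 * (2 - 2 * (r * s).trace.re) * frobSq O := by
  have hFr : frobSq r = 1 := by
    have := trace_conjTranspose_mul_self r
    rw [hr, hr1] at this
    exact_mod_cast this.symm
  have hFs : frobSq s = 1 := by
    have := trace_conjTranspose_mul_self s
    rw [hs, hs1] at this
    exact_mod_cast this.symm
  have hF : frobSq (r - s) = 2 - 2 * (r * s).trace.re := by
    have h := congrArg Complex.re (trace_conjTranspose_mul_self (r - s))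
    rw [Complex.ofReal_re, Matrix.conjTranspose_sub, hr, hs, sub_mul, mul_sub, mul_sub,
      Matrix.trace_sub, Matrix.trace_sub, Matrix.trace_sub, hr1, hs1,
      Matrix.trace_mul_comm s r] at h
    simp only [Complex.sub_re, Complex.one_re] at h
    linarith
  -- Uses `r² - s² = (r - s) r + s (r - s)` and cyclicity of the trace.
  have hsplit : ((r * r - s * s) * O).trace =
      ((r - s) * (r * O)).trace + ((r - s) * (O * s)).trace := by
    have : ((r - s) * (O * s)).trace = (s * ((r - s) * O)).trace := by
      rw [← mul_assoc, Matrix.trace_mul_comm]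
    rw [this, ← Matrix.trace_add]
    congr 1
    noncomm_ring
  have h1 : ‖((r - s) * (r * O)).trace‖ ^ 2 ≤ frobSq (r - s) * frobSq O :=
    (norm_trace_mul_sq_le _ _).trans <| mul_le_mul_of_nonneg_left
      ((frobSq_mul_le _ _).trans_eq (by rw [hFr, one_mul])) (frobSq_nonneg _)
  have h2 : ‖((r - s) * (O * s)).trace‖ ^ 2 ≤ frobSq (r - s) * frobSq O :=
    (norm_trace_mul_sq_le _ _).trans <| mul_le_mul_of_nonneg_left
      ((frobSq_mul_le _ _).trans_eq (by rw [hFs, mul_one])) (frobSq_nonneg _)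
  rw [hsplit, ← hF]
  calc _ ≤ (‖((r - s) * (r * O)).trace‖ + ‖((r - s) * (O * s)).trace‖) ^ 2 := by
        gcongr; exact norm_add_le _ _
    _ ≤ 2 * (‖((r - s) * (r * O)).trace‖ ^ 2 + ‖((r - s) * (O * s)).trace‖ ^ 2) := add_sq_le
    _ ≤ _ := by linarith

end Petz

/-! ### Reduced matrices, support of the joint state, and the first estimate. -/

section Reduced

variable {a b : Type*} [Fintype a] [DecidableEq a] [Fintype b] [DecidableEq b]

omit [DecidableEq a] in
lemma trace_mul_kronecker_one (ρ : Matrix (a × b) (a × b) ℂ) (X : Matrix a a ℂ) :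
    (ρ * (X ⊗ₖ (1 : Matrix b b ℂ))).trace = (reducedA ρ * X).trace := by
  simp only [Matrix.trace, Matrix.diag, Matrix.mul_apply, Fintype.sum_prod_type, reducedA,
    Matrix.of_apply, Matrix.kroneckerMap_apply, Finset.sum_mul]
  refine Finset.sum_congr rfl fun i _ => ?_
  rw [Finset.sum_comm]
  refine Finset.sum_congr rfl fun j _ => Finset.sum_congr rfl fun k _ => ?_
  simp [Matrix.one_apply]

omit [DecidableEq b] in
lemma trace_mul_one_kronecker (ρ : Matrix (a × b) (a × b) ℂ) (Y : Matrix b b ℂ) :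
    (ρ * ((1 : Matrix a a ℂ) ⊗ₖ Y)).trace = (reducedB ρ * Y).trace := by
  simp only [Matrix.trace, Matrix.diag, Matrix.mul_apply, Fintype.sum_prod_type, reducedB,
    Matrix.of_apply, Matrix.kroneckerMap_apply, Finset.sum_mul]
  rw [Finset.sum_comm]
  refine Finset.sum_congr rfl fun i _ => ?_
  rw [Finset.sum_comm (s := Finset.univ (α := b))]
  refine Finset.sum_congr rfl fun k _ => ?_
  rw [Finset.sum_comm]
  refine Finset.sum_congr rfl fun j _ => ?_
  simp [Matrix.one_apply]

lemma IsDensityMatrix.reducedA {ρ : Matrix (a × b) (a × b) ℂ} (hρ : IsDensityMatrix ρ) :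
    IsDensityMatrix (reducedA ρ) := by
  constructor
  · have : _root_.reducedA ρ = ∑ k, ρ.submatrix (fun i => (i, k)) (fun i => (i, k)) := by
      ext i j
      simp [_root_.reducedA, Matrix.sum_apply]
    rw [this]
    exact Matrix.posSemidef_sum _ fun k _ => hρ.1.submatrix _
  · have := trace_mul_kronecker_one ρ 1
    rw [Matrix.one_kronecker_one, mul_one, mul_one] at this
    rw [← this, hρ.2]

lemma IsDensityMatrix.reducedB {ρ : Matrix (a × b) (a × b) ℂ} (hρ : IsDensityMatrix ρ) :
    IsDensityMatrix (reducedB ρ) := by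
  constructor
  · have : _root_.reducedB ρ = ∑ k, ρ.submatrix (fun i => (k, i)) (fun i => (k, i)) := by
      ext i j
      simp [_root_.reducedB, Matrix.sum_apply]
    rw [this]
    exact Matrix.posSemidef_sum _ fun k _ => hρ.1.submatrix _
  · have := trace_mul_one_kronecker ρ 1
    rw [Matrix.one_kronecker_one, mul_one, mul_one] at this
    rw [← this, hρ.2]

omit [DecidableEq a] [DecidableEq b] in
lemma trace_conj_kronecker_mul (ρ : Matrix (a × b) (a × b) ℂ) (U X : Matrix a a ℂ)
    (V Y : Matrix b b ℂ) :
    ((U ⊗ₖ V)ᴴ * ρ * (U ⊗ₖ V) * (X ⊗ₖ Y)).trace =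
      (ρ * ((U * X * Uᴴ) ⊗ₖ (V * Y * Vᴴ))).trace := by
  rw [Matrix.mul_kronecker_mul, Matrix.mul_kronecker_mul, ← Matrix.conjTranspose_kronecker,
    mul_assoc, mul_assoc, Matrix.trace_mul_comm, mul_assoc]

omit [DecidableEq a] in
-- By trace duality it suffices to test against every `X`; the unitary on the second factor cancels
-- against the identity there.
lemma reducedA_conj_kronecker (ρ : Matrix (a × b) (a × b) ℂ) (U : Matrix a a ℂ)
    {V : Matrix b b ℂ} (hV : V * Vᴴ = 1) :
    reducedA ((U ⊗ₖ V)ᴴ * ρ * (U ⊗ₖ V)) = Uᴴ * reducedA ρ * U := by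
  refine Matrix.ext_iff_trace_mul_right.2 fun X => ?_
  rw [← trace_mul_kronecker_one, trace_conj_kronecker_mul, mul_one, hV, trace_mul_kronecker_one,
    mul_assoc, mul_assoc Uᴴ, mul_assoc Uᴴ, Matrix.trace_mul_comm Uᴴ]
  simp only [mul_assoc]

omit [DecidableEq b] in
lemma reducedB_conj_kronecker (ρ : Matrix (a × b) (a × b) ℂ) {U : Matrix a a ℂ}
    (hU : U * Uᴴ = 1) (V : Matrix b b ℂ) :
    reducedB ((U ⊗ₖ V)ᴴ * ρ * (U ⊗ₖ V)) = Vᴴ * reducedB ρ * V := by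
  refine Matrix.ext_iff_trace_mul_right.2 fun X => ?_
  rw [← trace_mul_one_kronecker, trace_conj_kronecker_mul, mul_one, hU, trace_mul_one_kronecker,
    mul_assoc, mul_assoc Vᴴ, mul_assoc Vᴴ, Matrix.trace_mul_comm Vᴴ]
  simp only [mul_assoc]

omit [Fintype a] [DecidableEq a] [DecidableEq b] in
lemma Matrix.PosSemidef.apply_eq_zero_of_reducedA {M : Matrix (a × b) (a × b) ℂ}
    (hM : M.PosSemidef) {i : a} (h : _root_.reducedA M i i = 0) (k : b) : M (i, k) (i, k) = 0 :=
  (Finset.sum_eq_zero_iff_of_nonneg fun _ _ => hM.diag_nonneg).1 h k (Finset.mem_univ k)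

omit [DecidableEq a] [Fintype b] [DecidableEq b] in
lemma Matrix.PosSemidef.apply_eq_zero_of_reducedB {M : Matrix (a × b) (a × b) ℂ}
    (hM : M.PosSemidef) {k : b} (h : _root_.reducedB M k k = 0) (i : a) : M (i, k) (i, k) = 0 :=
  (Finset.sum_eq_zero_iff_of_nonneg fun _ _ => hM.diag_nonneg).1 h i (Finset.mem_univ i)

lemma conjTranspose_mul_conjDiag_mul {U : Matrix a a ℂ} (hU : Uᴴ * U = 1) (d : a → ℝ) :
    Uᴴ * conjDiag U d * U = Matrix.diagonal (fun i => (d i : ℂ)) := by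
  rw [conjDiag, ← mul_assoc, ← mul_assoc, hU, one_mul, mul_assoc, hU, mul_one]

lemma conjDiag_kronecker_conjDiag (U : Matrix a a ℂ) (V : Matrix b b ℂ) (p : a → ℝ) (q : b → ℝ) :
    conjDiag U p ⊗ₖ conjDiag V q = conjDiag (U ⊗ₖ V) (fun i => p i.1 * q i.2) := by
  rw [conjDiag, conjDiag, Matrix.mul_kronecker_mul, Matrix.mul_kronecker_mul,
    ← Matrix.conjTranspose_kronecker, Matrix.diagonal_kronecker_diagonal]
  simp [conjDiag]

lemma IsDensityMatrix.exists_eq_conjDiag {ρ : Matrix a a ℂ} (hρ : IsDensityMatrix ρ) :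
    ∃ (U : Matrix a a ℂ) (p : a → ℝ), Uᴴ * U = 1 ∧ U * Uᴴ = 1 ∧ (∀ i, 0 ≤ p i) ∧
      ∑ i, p i = 1 ∧ ρ = conjDiag U p := by
  obtain ⟨U, p, hU, hU', hp, h⟩ := hρ.1.exists_eq_conjDiag
  refine ⟨U, p, hU, hU', hp, ?_, h⟩
  have := hρ.2
  rw [h, trace_conjDiag hU] at this
  exact_mod_cast this

/-- The Petz Rényi mutual information bounds the distance between the square roots of a density
matrix and of the product of its reduced matrices, hence differences of expectation values. -/
lemma mul_norm_trace_sub_sq_le_petzMutualInfo {ρ : Matrix (a × b) (a × b) ℂ}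
    (hρ : IsDensityMatrix ρ) {α : ℝ} (hα₀ : 0 < α) (hα₁ : α ≤ 1)
    (O : Matrix (a × b) (a × b) ℂ) :
    α * ‖((ρ - reducedA ρ ⊗ₖ reducedB ρ) * O).trace‖ ^ 2 ≤
      4 * petzMutualInfo α ρ * frobSq O := by
  obtain ⟨U, p, hU, hU', hp, hp1, hρU⟩ := hρ.exists_eq_conjDiag
  obtain ⟨VA, x, hVA, hVA', hx, hx1, hA⟩ := hρ.reducedA.exists_eq_conjDiag
  obtain ⟨VB, y, hVB, hVB', hy, hy1, hB⟩ := hρ.reducedB.exists_eq_conjDiag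
  have hV : (VA ⊗ₖ VB)ᴴ * (VA ⊗ₖ VB) = 1 := by
    rw [Matrix.conjTranspose_kronecker, ← Matrix.mul_kronecker_mul, hVA, hVB,
      Matrix.one_kronecker_one]
  have hV' : (VA ⊗ₖ VB) * (VA ⊗ₖ VB)ᴴ = 1 := mul_eq_one_comm.1 hV
  have hσ : reducedA ρ ⊗ₖ reducedB ρ = conjDiag (VA ⊗ₖ VB) (fun i => x i.1 * y i.2) := by
    rw [hA, hB, conjDiag_kronecker_conjDiag]
  have hq : ∀ i : a × b, 0 ≤ x i.1 * y i.2 := fun i => mul_nonneg (hx _) (hy _)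
  have hq1 : ∑ i : a × b, x i.1 * y i.2 = 1 := by
    rw [Fintype.sum_prod_type]
    simp_rw [← Finset.mul_sum, hy1, mul_one, hx1]
  -- The support of `ρ` lies in that of `ρ_A ⊗ ρ_B`: in the product eigenbasis, a zero eigenvalue of
  -- a reduced matrix is a sum of nonnegative diagonal entries of the rotated `ρ`, which must all
  -- vanish.
  have hsupp : ∀ j : a × b, x j.1 * y j.2 = 0 →
      ((VA ⊗ₖ VB)ᴴ * conjDiag U p * (VA ⊗ₖ VB)) j j = 0 := by
    rintro ⟨i, k⟩ h
    rw [← hρU]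
    have hM := hρ.1.conjTranspose_mul_mul_same (VA ⊗ₖ VB)
    rcases mul_eq_zero.1 h with h | h
    · refine hM.apply_eq_zero_of_reducedA ?_ k
      rw [reducedA_conj_kronecker ρ VA hVB', hA, conjTranspose_mul_conjDiag_mul hVA,
        Matrix.diagonal_apply_eq]
      exact_mod_cast h
    · refine hM.apply_eq_zero_of_reducedB ?_ i
      rw [reducedB_conj_kronecker ρ hVA' VB, hB, conjTranspose_mul_conjDiag_mul hVB,
        Matrix.diagonal_apply_eq]
      exact_mod_cast h
  have h1 := mul_le_petzRelEntropy hU hU' hV hV' hp hq hp1 hq1 hsupp hα₀ hα₁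
  rw [← hρU, ← hσ] at h1
  have hrr : conjDiag U (fun i => √(p i)) * conjDiag U (fun i => √(p i)) = ρ := by
    rw [conjDiag_mul_conjDiag hU, hρU]
    simp_rw [fun i => Real.mul_self_sqrt (hp i)]
  have hss : conjDiag (VA ⊗ₖ VB) (fun i => √(x i.1 * y i.2)) *
      conjDiag (VA ⊗ₖ VB) (fun i => √(x i.1 * y i.2)) = reducedA ρ ⊗ₖ reducedB ρ := by
    rw [conjDiag_mul_conjDiag hV, hσ]
    simp_rw [fun i => Real.mul_self_sqrt (hq i)]
  have h2 := norm_trace_sub_mul_sq_le (conjDiag_isHermitian U (fun i => √(p i)))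
    (conjDiag_isHermitian (VA ⊗ₖ VB) (fun i => √(x i.1 * y i.2))) (by rw [hrr, hρ.2])
    (by rw [hss, Matrix.trace_kronecker, hρ.reducedA.2, hρ.reducedB.2, mul_one]) O
  rw [hrr, hss] at h2
  have h3 := mul_le_mul_of_nonneg_left h2 hα₀.le
  have h4 := mul_le_mul_of_nonneg_right h1 (frobSq_nonneg O)
  rw [petzMutualInfo]
  linarith

end Reduced

/-! ### Variances in a state and their bound by the Frobenius norm. -/

section Variance

variable {n : Type*} [Fintype n] [DecidableEq n]

/-- Expand `∑ i, ∑ j, p i * p j * (x i + x j) ^ 2` and keep only its diagonal `∑ i, 4 * p i ^ 2 * x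
i ^ 2`; then add `0 ≤ ∑ i, x i ^ 2 * (1 - 2 * p i) ^ 2`. -/
lemma two_mul_sum_mul_sq_le {p : n → ℝ} (hp : ∀ i, 0 ≤ p i) (hp1 : ∑ i, p i = 1) (x : n → ℝ) :
    2 * ∑ i, p i * x i ^ 2 ≤ ∑ i, x i ^ 2 + 2 * (∑ i, p i * x i) ^ 2 := by
  have hsq : (∑ i, p i * x i) ^ 2 = ∑ i, ∑ j, p i * p j * (x i * x j) := by
    rw [sq, Finset.sum_mul_sum]
    exact Finset.sum_congr rfl fun i _ => Finset.sum_congr rfl fun j _ => by ring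
  have h1 : ∑ i, ∑ j, (if i = j then 4 * p i ^ 2 * x i ^ 2 else 0) ≤
      ∑ i, ∑ j, (p i * p j * x i ^ 2 + p i * p j * x j ^ 2 + 2 * (p i * p j * (x i * x j))) := by
    refine Finset.sum_le_sum fun i _ => Finset.sum_le_sum fun j _ => ?_
    split_ifs with h
    · subst h; apply le_of_eq; ring
    · nlinarith [mul_nonneg (mul_nonneg (hp i) (hp j)) (sq_nonneg (x i + x j))]
  have h2 : ∑ i, ∑ j, p i * p j * x i ^ 2 = ∑ i, p i * x i ^ 2 := by
    refine Finset.sum_congr rfl fun i _ => ?_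
    rw [← Finset.sum_mul, ← Finset.mul_sum, hp1, mul_one]
  have h3 : ∑ i, ∑ j, p i * p j * x j ^ 2 = ∑ i, p i * x i ^ 2 := by
    rw [Finset.sum_comm, ← h2]
    exact Finset.sum_congr rfl fun i _ => Finset.sum_congr rfl fun j _ => by ring
  simp only [Finset.sum_add_distrib, ← Finset.mul_sum, h2, h3, ← hsq, Finset.sum_ite_eq,
    Finset.mem_univ, if_true] at h1
  have h4 : 0 ≤ ∑ i, (x i ^ 2 - 4 * (p i * x i ^ 2) + 4 * p i ^ 2 * x i ^ 2) :=
    Finset.sum_nonneg fun i _ => by nlinarith [sq_nonneg (x i * (1 - 2 * p i))]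
  rw [Finset.sum_add_distrib, Finset.sum_sub_distrib, ← Finset.mul_sum] at h4
  linarith

lemma two_mul_sum_mul_norm_sq_le {p : n → ℝ} (hp : ∀ i, 0 ≤ p i) (hp1 : ∑ i, p i = 1)
    (z : n → ℂ) :
    2 * ∑ i, p i * ‖z i‖ ^ 2 ≤ ∑ i, ‖z i‖ ^ 2 + 2 * ‖∑ i, (p i : ℂ) * z i‖ ^ 2 := by
  have h1 := two_mul_sum_mul_sq_le hp hp1 (fun i => (z i).re)
  have h2 := two_mul_sum_mul_sq_le hp hp1 (fun i => (z i).im)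
  simp only [Complex.sq_norm, Complex.normSq_apply, Complex.re_sum, Complex.im_sum,
    Complex.re_ofReal_mul, Complex.im_ofReal_mul, ← sq, mul_add, Finset.sum_add_distrib]
  linarith

omit [DecidableEq n] in
lemma mul_conjTranspose_self_apply (X : Matrix n n ℂ) (i : n) :
    (X * Xᴴ) i i = ((∑ j, ‖X i j‖ ^ 2 : ℝ) : ℂ) := by
  rw [Matrix.mul_apply]
  push_cast
  refine Finset.sum_congr rfl fun j _ => ?_
  rw [Matrix.conjTranspose_apply, RCLike.star_def, Complex.mul_conj']

omit [DecidableEq n] in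
lemma conjTranspose_mul_self_apply (X : Matrix n n ℂ) (i : n) :
    (Xᴴ * X) i i = ((∑ j, ‖X j i‖ ^ 2 : ℝ) : ℂ) := by
  simpa [Matrix.conjTranspose_apply] using mul_conjTranspose_self_apply Xᴴ i

/-- The symmetrized variance of an operator is at most its squared Frobenius norm. -/
lemma IsDensityMatrix.symm_variance_le {ρ : Matrix n n ℂ} (hρ : IsDensityMatrix ρ)
    (A : Matrix n n ℂ) :
    (ρ * (A * Aᴴ)).trace.re + (ρ * (Aᴴ * A)).trace.re ≤
      frobSq A + 2 * ‖(ρ * A).trace‖ ^ 2 := by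
  obtain ⟨U, p, hU, hU', hp, hp1, rfl⟩ := hρ.exists_eq_conjDiag
  set B := Uᴴ * A * U with hB
  have hBB : Uᴴ * (A * Aᴴ) * U = B * Bᴴ := by
    have : B * Bᴴ = Uᴴ * A * (U * Uᴴ) * Aᴴ * U := by
      simp only [hB, Matrix.conjTranspose_mul, Matrix.conjTranspose_conjTranspose, mul_assoc]
    rw [this, hU', mul_one]
    simp only [mul_assoc]
  have hBB' : Uᴴ * (Aᴴ * A) * U = Bᴴ * B := by
    have : Bᴴ * B = Uᴴ * Aᴴ * (U * Uᴴ) * A * U := by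
      simp only [hB, Matrix.conjTranspose_mul, Matrix.conjTranspose_conjTranspose, mul_assoc]
    rw [this, hU', mul_one]
    simp only [mul_assoc]
  have hF : frobSq B = frobSq A := by
    have h := trace_mul_conjTranspose_self B
    rw [← hBB, mul_assoc, Matrix.trace_mul_comm, mul_assoc, hU', mul_one,
      trace_mul_conjTranspose_self] at h
    exact_mod_cast h.symm
  have h1 : (conjDiag U p * (A * Aᴴ)).trace.re = ∑ i, ∑ j, p i * ‖B i j‖ ^ 2 := by
    simp only [trace_conjDiag_mul, hBB, mul_conjTranspose_self_apply, Complex.re_sum,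
      Complex.re_ofReal_mul, Complex.ofReal_re, Finset.mul_sum]
  have h2 : (conjDiag U p * (Aᴴ * A)).trace.re = ∑ i, ∑ j, p j * ‖B i j‖ ^ 2 := by
    rw [Finset.sum_comm]
    simp only [trace_conjDiag_mul, hBB', conjTranspose_mul_self_apply, Complex.re_sum,
      Complex.re_ofReal_mul, Complex.ofReal_re, Finset.mul_sum]
  have h3 := two_mul_sum_mul_norm_sq_le hp hp1 (fun i => B i i)
  rw [← trace_conjDiag_mul] at h3
  -- In the eigenbasis the left side of the goal is `∑ (p i + p j) ‖B i j‖²`. Off the diagonal `p i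
  -- + p j ≤ 1`; on it `2 * p i` may exceed `1`, and `h3` pays for the excess with the squared mean.
  have h4 : ∑ i, ∑ j, (if i = j then (2 * (p i * ‖B i i‖ ^ 2) - ‖B i i‖ ^ 2) else 0) ≥
      ∑ i, ∑ j, (p i * ‖B i j‖ ^ 2 + p j * ‖B i j‖ ^ 2 - ‖B i j‖ ^ 2) := by
    refine Finset.sum_le_sum fun i _ => Finset.sum_le_sum fun j _ => ?_
    split_ifs with h
    · subst h; apply le_of_eq; ring
    · have : p i + p j ≤ 1 := by
        rw [← hp1, ← Finset.sum_pair h]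
        exact Finset.sum_le_sum_of_subset_of_nonneg (Finset.subset_univ _) fun i _ _ => hp i
      nlinarith [sq_nonneg ‖B i j‖]
  simp only [Finset.sum_ite_eq, Finset.mem_univ, if_true, Finset.sum_sub_distrib,
    Finset.sum_add_distrib, ← Finset.mul_sum (a := (2 : ℝ))] at h4
  rw [h1, h2, ← hF]
  unfold frobSq
  linarith

lemma IsDensityMatrix.exists_sqrt {ρ : Matrix n n ℂ} (hρ : IsDensityMatrix ρ) :
    ∃ r : Matrix n n ℂ, rᴴ = r ∧ r * r = ρ ∧ frobSq r = 1 := by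
  obtain ⟨U, p, hU, hU', hp, hp1, h⟩ := hρ.exists_eq_conjDiag
  have hr := conjDiag_isHermitian U (fun i => √(p i))
  have hrr : conjDiag U (fun i => √(p i)) * conjDiag U (fun i => √(p i)) = ρ := by
    rw [conjDiag_mul_conjDiag hU, h]
    simp_rw [fun i => Real.mul_self_sqrt (hp i)]
  refine ⟨_, hr, hrr, ?_⟩
  have := trace_conjTranspose_mul_self (conjDiag U (fun i => √(p i)))
  rw [hr, hrr, hρ.2] at this
  exact_mod_cast this.symm

omit [DecidableEq n] in
lemma trace_mul_self_mul_conjTranspose {r : Matrix n n ℂ} (hr : rᴴ = r) (X : Matrix n n ℂ) :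
    (r * r * (X * Xᴴ)).trace.re = frobSq (r * X) := by
  have := trace_mul_conjTranspose_self (r * X)
  rw [Matrix.conjTranspose_mul, hr, ← mul_assoc, Matrix.trace_mul_comm] at this
  rw [← Complex.ofReal_re (frobSq (r * X)), ← this]
  simp only [mul_assoc]

lemma IsDensityMatrix.trace_mul_mul_conjTranspose_le {ρ : Matrix n n ℂ} (hρ : IsDensityMatrix ρ)
    (X : Matrix n n ℂ) : (ρ * (X * Xᴴ)).trace.re ≤ frobSq X := by
  obtain ⟨r, hr, rfl, hr1⟩ := hρ.exists_sqrt
  rw [trace_mul_self_mul_conjTranspose hr]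
  exact (frobSq_mul_le r X).trans_eq (by rw [hr1, one_mul])

lemma IsDensityMatrix.trace_mul_mul_conjTranspose_nonneg {ρ : Matrix n n ℂ}
    (hρ : IsDensityMatrix ρ) (X : Matrix n n ℂ) : 0 ≤ (ρ * (X * Xᴴ)).trace.re := by
  obtain ⟨r, hr, rfl, hr1⟩ := hρ.exists_sqrt
  rw [trace_mul_self_mul_conjTranspose hr]
  exact frobSq_nonneg _

/-- Cauchy-Schwarz for `Tr ((r X) (Y r))`, where `r` is the square root of `ρ`. -/
lemma IsDensityMatrix.norm_trace_mul_sq_le {ρ : Matrix n n ℂ} (hρ : IsDensityMatrix ρ)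
    (X Y : Matrix n n ℂ) :
    ‖(ρ * (X * Y)).trace‖ ^ 2 ≤ (ρ * (X * Xᴴ)).trace.re * (ρ * (Yᴴ * Y)).trace.re := by
  obtain ⟨r, hr, rfl, hr1⟩ := hρ.exists_sqrt
  have h := trace_mul_self_mul_conjTranspose hr Yᴴ
  rw [Matrix.conjTranspose_conjTranspose, ← frobSq_conjTranspose, Matrix.conjTranspose_mul,
    Matrix.conjTranspose_conjTranspose, hr] at h
  rw [h, trace_mul_self_mul_conjTranspose hr]
  have h2 : (r * r * (X * Y)).trace = ((r * X) * (Y * r)).trace := by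
    rw [mul_assoc, Matrix.trace_mul_comm]
    simp only [mul_assoc]
  rw [h2]
  exact _root_.norm_trace_mul_sq_le _ _

omit [DecidableEq n] in
lemma IsDensityMatrix.trace_mul_conjTranspose {ρ : Matrix n n ℂ} (hρ : IsDensityMatrix ρ)
    (A : Matrix n n ℂ) : (ρ * Aᴴ).trace = star (ρ * A).trace := by
  rw [← Matrix.trace_conjTranspose, Matrix.conjTranspose_mul, hρ.1.1, Matrix.trace_mul_comm]

lemma IsDensityMatrix.trace_centered {ρ : Matrix n n ℂ} (hρ : IsDensityMatrix ρ)
    (A : Matrix n n ℂ) :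
    (ρ * ((A - (ρ * A).trace • 1) * (A - (ρ * A).trace • 1)ᴴ)).trace.re =
      (ρ * (A * Aᴴ)).trace.re - ‖(ρ * A).trace‖ ^ 2 := by
  set c := (ρ * A).trace with hc
  have h : (ρ * ((A - c • 1) * (A - c • 1)ᴴ)).trace =
      (ρ * (A * Aᴴ)).trace - ((‖c‖ ^ 2 : ℝ) : ℂ) := by
    have : ρ * ((A - c • 1) * (A - c • 1)ᴴ) =
        ρ * (A * Aᴴ) - star c • (ρ * A) - c • (ρ * Aᴴ) + (c * star c) • ρ := by
      simp only [Matrix.conjTranspose_sub, Matrix.conjTranspose_smul, Matrix.conjTranspose_one,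
        sub_mul, mul_sub, smul_mul_assoc, mul_smul_comm, one_mul, mul_one, smul_sub, smul_smul,
        mul_comm c]
      abel
    rw [this]
    simp only [Matrix.trace_add, Matrix.trace_sub, Matrix.trace_smul, hρ.trace_mul_conjTranspose,
      hρ.2, ← hc, smul_eq_mul, mul_one]
    push_cast
    rw [← Complex.mul_conj', RCLike.star_def]
    ring
  rw [h, Complex.sub_re, Complex.ofReal_re]

lemma IsDensityMatrix.trace_centered' {ρ : Matrix n n ℂ} (hρ : IsDensityMatrix ρ)
    (A : Matrix n n ℂ) :
    (ρ * ((A - (ρ * A).trace • 1)ᴴ * (A - (ρ * A).trace • 1))).trace.re =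
      (ρ * (Aᴴ * A)).trace.re - ‖(ρ * A).trace‖ ^ 2 := by
  have h := hρ.trace_centered Aᴴ
  rw [hρ.trace_mul_conjTranspose, norm_star] at h
  simpa [Matrix.conjTranspose_sub, Matrix.conjTranspose_smul] using h

end Variance

/-! ### Forms of the connected correlator and its a priori bound. -/

section Correlator

variable {a b : Type*} [Fintype a] [DecidableEq a] [Fintype b] [DecidableEq b]

lemma kronecker_eq_mul (A : Matrix a a ℂ) (B : Matrix b b ℂ) :
    (A ⊗ₖ (1 : Matrix b b ℂ)) * ((1 : Matrix a a ℂ) ⊗ₖ B) = A ⊗ₖ B := by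
  rw [← Matrix.mul_kronecker_mul, mul_one, one_mul]

lemma connectedCorrelator_eq (ρ : Matrix (a × b) (a × b) ℂ) (A : Matrix a a ℂ)
    (B : Matrix b b ℂ) :
    connectedCorrelator ρ A B =
      ‖(ρ * (A ⊗ₖ B)).trace - (reducedA ρ * A).trace * (reducedB ρ * B).trace‖ := by
  rw [connectedCorrelator, expectation, expectation, expectation, kronecker_eq_mul,
    trace_mul_kronecker_one, trace_mul_one_kronecker]

lemma connectedCorrelator_eq_norm_trace_sub (ρ : Matrix (a × b) (a × b) ℂ) (A : Matrix a a ℂ)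
    (B : Matrix b b ℂ) :
    connectedCorrelator ρ A B =
      ‖((ρ - reducedA ρ ⊗ₖ reducedB ρ) * (A ⊗ₖ B)).trace‖ := by
  rw [connectedCorrelator_eq, sub_mul, Matrix.trace_sub, ← Matrix.mul_kronecker_mul,
    Matrix.trace_kronecker]

/-- With centred operators, Cauchy-Schwarz yields variances instead of second moments. -/
lemma connectedCorrelator_eq_norm_trace_centered {ρ : Matrix (a × b) (a × b) ℂ}
    (hρ : IsDensityMatrix ρ) (A : Matrix a a ℂ) (B : Matrix b b ℂ) :
    connectedCorrelator ρ A B =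
      ‖(ρ * ((A - (reducedA ρ * A).trace • 1) ⊗ₖ (B - (reducedB ρ * B).trace • 1))).trace‖ := by
  rw [connectedCorrelator_eq]
  set x := (reducedA ρ * A).trace with hx
  set y := (reducedB ρ * B).trace with hy
  have : (A - x • 1) ⊗ₖ (B - y • 1) = A ⊗ₖ B - x • ((1 : Matrix a a ℂ) ⊗ₖ B)
      - y • (A ⊗ₖ (1 : Matrix b b ℂ)) + (x * y) • 1 := by
    rw [← Matrix.one_kronecker_one]
    ext ⟨i, k⟩ ⟨j, l⟩
    simp only [Matrix.kroneckerMap_apply, Matrix.sub_apply, Matrix.add_apply, Matrix.smul_apply,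
      smul_eq_mul]
    ring
  rw [this]
  simp only [mul_add, mul_sub, mul_smul_comm, Matrix.trace_add, Matrix.trace_sub,
    Matrix.trace_smul, trace_mul_one_kronecker, trace_mul_kronecker_one, mul_one, hρ.2,
    ← hx, ← hy, smul_eq_mul]
  congr 1
  ring

omit [DecidableEq a] [DecidableEq b] in
lemma frobSq_kronecker (A : Matrix a a ℂ) (B : Matrix b b ℂ) :
    frobSq (A ⊗ₖ B) = frobSq A * frobSq B := by
  have h := trace_conjTranspose_mul_self (A ⊗ₖ B)
  rw [Matrix.conjTranspose_kronecker, ← Matrix.mul_kronecker_mul, Matrix.trace_kronecker,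
    trace_conjTranspose_mul_self, trace_conjTranspose_mul_self] at h
  exact_mod_cast h.symm

/-- The a priori bound on the connected correlator. -/
lemma two_mul_connectedCorrelator_sq_le {ρ : Matrix (a × b) (a × b) ℂ}
    (hρ : IsDensityMatrix ρ) (A : Matrix a a ℂ) (B : Matrix b b ℂ) :
    2 * connectedCorrelator ρ A B ^ 2 ≤ frobSq A * frobSq B := by
  rw [connectedCorrelator_eq_norm_trace_centered hρ]
  have hA1 := hρ.reducedA.trace_centered A
  have hA2 := hρ.reducedA.trace_centered' A
  have hB1 := hρ.reducedB.trace_centered B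
  have hB2 := hρ.reducedB.trace_centered' B
  set X := A - (reducedA ρ * A).trace • (1 : Matrix a a ℂ)
  set Y := B - (reducedB ρ * B).trace • (1 : Matrix b b ℂ)
  -- The two factors commute, so Cauchy-Schwarz applies in both orders and gives `c ≤ u * t` and `c
  -- ≤ s * v`. Adding them brings in `u + v`, the symmetrized variance, which is at most `frobSq A`;
  -- this is the source of the factor `2`.
  have h1 := hρ.norm_trace_mul_sq_le (X ⊗ₖ (1 : Matrix b b ℂ)) ((1 : Matrix a a ℂ) ⊗ₖ Y)
  have h2 := hρ.norm_trace_mul_sq_le ((1 : Matrix a a ℂ) ⊗ₖ Y) (X ⊗ₖ (1 : Matrix b b ℂ))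
  simp only [Matrix.conjTranspose_kronecker, Matrix.conjTranspose_one,
    ← Matrix.mul_kronecker_mul, mul_one, one_mul, trace_mul_kronecker_one,
    trace_mul_one_kronecker] at h1 h2
  have hs := hρ.reducedA.symm_variance_le A
  have hb1 := hρ.reducedB.trace_mul_mul_conjTranspose_le B
  have hb2 := hρ.reducedB.trace_mul_mul_conjTranspose_le Bᴴ
  rw [Matrix.conjTranspose_conjTranspose, frobSq_conjTranspose] at hb2
  have hx1 := hρ.reducedA.trace_mul_mul_conjTranspose_nonneg X
  have hx2 := hρ.reducedA.trace_mul_mul_conjTranspose_nonneg Xᴴ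
  have hy1 := hρ.reducedB.trace_mul_mul_conjTranspose_nonneg Y
  have hy2 := hρ.reducedB.trace_mul_mul_conjTranspose_nonneg Yᴴ
  rw [Matrix.conjTranspose_conjTranspose] at hx2 hy2
  set u := (reducedA ρ * (X * Xᴴ)).trace.re
  set v := (reducedA ρ * (Xᴴ * X)).trace.re
  set s := (reducedB ρ * (Y * Yᴴ)).trace.re
  set t := (reducedB ρ * (Yᴴ * Y)).trace.re
  have hs1 : s ≤ frobSq B := by rw [hB1]; linarith [sq_nonneg ‖(reducedB ρ * B).trace‖]
  have ht1 : t ≤ frobSq B := by rw [hB2]; linarith [sq_nonneg ‖(reducedB ρ * B).trace‖]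
  have huv : u + v ≤ frobSq A := by rw [hA1, hA2]; linarith
  have hA0 := frobSq_nonneg A
  have hB0 := frobSq_nonneg B
  set c := ‖(ρ * (X ⊗ₖ Y)).trace‖ ^ 2
  have hc : 0 ≤ c := sq_nonneg _
  have h3 : c ≤ u * frobSq B := h1.trans (mul_le_mul_of_nonneg_left ht1 hx1)
  have h4 : c ≤ v * frobSq B := h2.trans <|
    (mul_comm s v).trans_le (mul_le_mul_of_nonneg_left hs1 hx2)
  calc 2 * c ≤ (u + v) * frobSq B := by linarith
    _ ≤ frobSq A * frobSq B := mul_le_mul_of_nonneg_right huv hB0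

end Correlator

theorem mainTheorem6 {a b : Type*} [Fintype a] [DecidableEq a] [Fintype b] [DecidableEq b]
    (ρ : Matrix (a × b) (a × b) ℂ) (hρ : IsDensityMatrix ρ)
    (OA : Matrix a a ℂ) (OB : Matrix b b ℂ) (hOA : OA ≠ 0) (hOB : OB ≠ 0)
    (α : ℝ) (hα₀ : 0 < α) (hα₁ : α ≤ 1) :
    α * connectedCorrelator ρ OA OB ^ 4 /
        (2 * schattenNorm 2 OA ^ 4 * schattenNorm 2 OB ^ 4)
      ≤ petzMutualInfo α ρ := by
  have h4 : ∀ x : ℝ, x ^ 4 = (x ^ 2) ^ 2 := fun x => by ring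
  rw [h4 (schattenNorm 2 OA), h4 (schattenNorm 2 OB), schattenNorm_two_sq, schattenNorm_two_sq]
  have h1 := mul_norm_trace_sub_sq_le_petzMutualInfo hρ hα₀ hα₁ (OA ⊗ₖ OB)
  rw [← connectedCorrelator_eq_norm_trace_sub, frobSq_kronecker] at h1
  have h2 := two_mul_connectedCorrelator_sq_le hρ OA OB
  have hA := frobSq_pos hOA
  have hB := frobSq_pos hOB
  rw [div_le_iff₀ (by positivity)]
  have hN : 0 < frobSq OA * frobSq OB := mul_pos hA hB
  set c := connectedCorrelator ρ OA OB
  -- With `N = frobSq OA * frobSq OB`, these read `2 α c⁴ ≤ α c² N` and `α c² N ≤ 4 I N²`.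
  have h3 := mul_le_mul_of_nonneg_left h2 (mul_nonneg hα₀.le (sq_nonneg c))
  have h5 := mul_le_mul_of_nonneg_right h1 hN.le
  linarith
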